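/- Let $d\ge 2$ be an integer, $0<\alpha<d$ and $1<p<q<\infty$. For a measurable function $b:\mathbb R^d\to\mathbb R$ put $$\|b\|_{\dot E_{q,\alpha}}:=\sup_{\rho>0}\rho^{\alpha}\sup_{x\in\mathbb R^d}\Big(\frac1{|B_\rho(x)|}\int_{B_\rho(x)}|b(y)|^q\,dy\Big)^{1/q},\qquad B_\rho(x)=\{y\in\mathbb R^d:|y-x|<\rho\},$$ and let the homogeneous Morrey space $\dot E_{q,\alpha}$ consist of the measurable $b$ with $\|b\|_{\dot E_{q,\alpha}}<\infty$. For $f:\mathbb R^d\to\mathbb R$ let $$P_\alpha f(x)=\int_{\mathbb R^d}\frac{f(y)}{|x-y|^{d-\alpha}}\,dy$$ be the Riesz potential of $f$. **Theorem (Adams).** There is a constant $N=N(d,\alpha,p,q)<\infty$ such that for all $b\in\dot E_{q,\alpha}$ and $f\in L_p(\mathbb R^d)$ the integral $P_\alpha f(x)$ converges absolutely for almost every $x$ with $b(x)\ne0$, the function $bP_\alpha f$ (understood as $0$ where $b=0$) belongs to $L_p(\mathbb R^d)$, and $$\|b\,P_\alpha f\|_{L_p(\mathbb R^d)}\le N\,\|b\|_{\dot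 E_{q,\alpha}}\,\|f\|_{L_p(\mathbb R^d)}.$$ -/

import Mathlib

open MeasureTheory Metric
open scoped ENNReal NNReal

/-- The averaged `L_q` norm `(|Γ|⁻¹ ∫_Γ |g|^q dx)^(1/q)` of a function on a set `Γ ⊆ ℝ^d`,
as an extended nonnegative number. -/
noncomputable def avgLpENorm {d : ℕ} (q : ℝ) (Γ : Set (EuclideanSpace ℝ (Fin d)))
    (g : EuclideanSpace ℝ (Fin d) → ℝ) : ℝ≥0∞ :=
  (⨍⁻ y in Γ, ‖g y‖ₑ ^ q ∂volume) ^ (1 / q)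

/-- The homogeneous Morrey norm: the supremum over `ρ > 0` and over all open balls `B` of
radius `ρ` of `ρ^β` times the averaged `L_q` norm on `B`. -/
noncomputable def morreyENorm {d : ℕ} (q β : ℝ) (g : EuclideanSpace ℝ (Fin d) → ℝ) : ℝ≥0∞ :=
  ⨆ (ρ : ℝ) (_ : 0 < ρ),
    ENNReal.ofReal (ρ ^ β) * ⨆ x : EuclideanSpace ℝ (Fin d), avgLpENorm q (ball x ρ) g

/-- Membership in the homogeneous Morrey space: (Lebesgue) measurability and finite norm. -/
def MemMorrey {d : ℕ} (q β : ℝ) (g : EuclideanSpace ℝ (Fin d) → ℝ) : Prop :=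
  AEStronglyMeasurable g volume ∧ morreyENorm q β g < ∞

/-- The integrand `y ↦ f y / |x - y|^(d - α)` of the Riesz potential at `x`. -/
noncomputable def rieszIntegrand {d : ℕ} (α : ℝ) (f : EuclideanSpace ℝ (Fin d) → ℝ)
    (x y : EuclideanSpace ℝ (Fin d)) : ℝ :=
  f y / ‖x - y‖ ^ ((d : ℝ) - α)

/-- The Riesz potential `P_α f`; meaningful at the points where the integrand is integrable. -/
noncomputable def rieszPotential {d : ℕ} (α : ℝ) (f : EuclideanSpace ℝ (Fin d) → ℝ)
    (x : EuclideanSpace ℝ (Fin d)) : ℝ :=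
  ∫ y, rieszIntegrand α f x y

/-!
# Adams' inequality for Riesz potentials and Morrey weights

After normalisation, `F = |b| ^ q` satisfies `∫_{B_r(x)} F ≤ r ^ (d - αq)` for all balls, and one
has to bound `∫ F ^ (p / q) (P_α f) ^ p` by `∫ f ^ p`. This is done by Schur's test, with a test
function built from a potential of `F` itself; neither maximal functions nor duality are used.

Let `w = P_γ F` with a small `γ > 0`, and `κ = αq - γ`, so that `w` scales like a function
homogeneous of degree `-κ`. On every ball `B = B_r(x)` there are two sorts of bounds:

* `∫_B w ≲ r ^ d * w x` and `∫_B F ≤ r ^ (d - γ) * w x`, useful for small `r`;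
* `∫_B w ≲ r ^ (d - κ)` and `∫_B F ≤ r ^ (d - αq)`, useful for large `r`.

By Hölder's inequality they pass to `F ^ s * w ^ e` when `s + e ≤ 1`. Writing `P_α` as the integral
over `r` of `r ^ (α - d - 1)` times the mass of `B_r(x)`, and splitting that integral at the radius
where the two bounds agree (`rieszLIntegral_le_of_ball_le`), one finds that
`P_α (F ^ s * w ^ e) ≲ w ^ ((αqs + κe - α) / κ)`
(`exists_rieszLIntegral_rpow_mul_rpow_le`): applying `P_α` acts on the scale of powers of `w` as
plain homogeneity predicts.

For `h = α / κ + η` with `η > 0` small, this gives, for `H = w ^ h`, both `P_α H ≲ w ^ η` and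
`P_α (F ^ (p / q) * (w ^ η) ^ (p - 1)) ≲ H ^ (p - 1)`. These are the two hypotheses of Schur's test
(`lintegral_mul_rpow_le_of_schur`) for the operator `f ↦ F ^ (1 / q) * P_α f` on `L_p`.
-/

/-! ### Riesz potentials as integrals over balls -/

theorem lintegral_Ioi_ofReal_rpow {a c : ℝ} (ha : 0 < a) (hc : 0 < c) :
    ∫⁻ r in Set.Ioi c, ENNReal.ofReal r ^ (-a - 1) =
      ENNReal.ofReal c ^ (-a) / ENNReal.ofReal a := by
  have h1 : ∫⁻ r in Set.Ioi c, ENNReal.ofReal r ^ (-a - 1) =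
      ∫⁻ r in Set.Ioi c, ENNReal.ofReal (r ^ (-a - 1)) :=
    setLIntegral_congr_fun measurableSet_Ioi fun r hr =>
      ENNReal.ofReal_rpow_of_pos (hc.trans hr)
  rw [h1, ← ofReal_integral_eq_lintegral_ofReal
    (integrableOn_Ioi_rpow_of_lt (by linarith) hc)
    ((ae_restrict_iff' measurableSet_Ioi).2 (.of_forall fun r hr =>
      Real.rpow_nonneg (hc.trans hr).le _)),
    integral_Ioi_rpow_of_lt (by linarith) hc, ENNReal.ofReal_rpow_of_pos hc,
    ← ENNReal.ofReal_div_of_pos ha]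
  congr 1
  rw [sub_add_cancel, neg_div_neg_eq]

theorem lintegral_Ioc_ofReal_rpow {a c : ℝ} (ha : 0 < a) (hc : 0 < c) :
    ∫⁻ r in Set.Ioc 0 c, ENNReal.ofReal r ^ (a - 1) =
      ENNReal.ofReal c ^ a / ENNReal.ofReal a := by
  have h1 : ∫⁻ r in Set.Ioc 0 c, ENNReal.ofReal r ^ (a - 1) =
      ∫⁻ r in Set.Ioc 0 c, ENNReal.ofReal (r ^ (a - 1)) :=
    setLIntegral_congr_fun measurableSet_Ioc fun r hr => ENNReal.ofReal_rpow_of_pos hr.1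
  rw [h1, ← ofReal_integral_eq_lintegral_ofReal
    ((intervalIntegrable_iff_integrableOn_Ioc_of_le hc.le).1
      (intervalIntegral.intervalIntegrable_rpow' (by linarith)))
    ((ae_restrict_iff' measurableSet_Ioc).2 (.of_forall fun r hr =>
      Real.rpow_nonneg hr.1.le _)),
    ← intervalIntegral.integral_of_le hc.le, integral_rpow (.inl (by linarith)),
    ENNReal.ofReal_rpow_of_pos hc, ← ENNReal.ofReal_div_of_pos ha]
  congr 1
  rw [sub_add_cancel, Real.zero_rpow ha.ne', sub_zero]


variable {d : ℕ}

/-- The Riesz potential of a nonnegative extended-valued function. The kernel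
`edist x y ^ (α - d)` takes the value `∞` on the diagonal when `α < d`. -/
noncomputable def rieszLIntegral (α : ℝ) (F : EuclideanSpace ℝ (Fin d) → ℝ≥0∞)
    (x : EuclideanSpace ℝ (Fin d)) : ℝ≥0∞ :=
  ∫⁻ y, F y * edist x y ^ (α - d)

theorem measurable_rieszLIntegral {α : ℝ} {F : EuclideanSpace ℝ (Fin d) → ℝ≥0∞}
    (hF : Measurable F) : Measurable (rieszLIntegral α F) := by
  refine Measurable.lintegral_prod_right
    (f := fun x y : EuclideanSpace ℝ (Fin d) => F y * edist x y ^ (α - d)) ?_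
  exact (hF.comp measurable_snd).mul (measurable_edist.pow_const _)

/-- The potential with kernel truncated at distance `ρ` is an integral over the radii `r > ρ` of the
mass of `F` in `ball x r`: integrate `t ^ (-s) = s * ∫_{r > t} r ^ (-s - 1)` against `F`. -/
theorem lintegral_mul_max_edist_rpow_le [NeZero d] {s : ℝ} (hs : 0 < s)
    {F : EuclideanSpace ℝ (Fin d) → ℝ≥0∞} (hF : Measurable F)
    (x : EuclideanSpace ℝ (Fin d)) (ρ : ℝ) :
    ∫⁻ y, F y * max (edist x y) (ENNReal.ofReal ρ) ^ (-s) ≤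
      ENNReal.ofReal s *
        ∫⁻ r in Set.Ioi ρ, ENNReal.ofReal r ^ (-s - 1) * ∫⁻ y in ball x r, F y := by
  have hmeas : Measurable (Function.uncurry fun (r : ℝ) (y : EuclideanSpace ℝ (Fin d)) =>
      ENNReal.ofReal r ^ (-s - 1) * (ball x r).indicator F y) := by
    have hset : MeasurableSet {z : ℝ × EuclideanSpace ℝ (Fin d) | dist z.2 x < z.1} :=
      measurableSet_lt (measurable_snd.dist measurable_const) measurable_fst
    have h := (hF.comp measurable_snd).indicator hset
    exact (measurable_fst.ennreal_ofReal.pow_const _).mul h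
  have hswap : ∫⁻ r in Set.Ioi ρ, ENNReal.ofReal r ^ (-s - 1) * ∫⁻ y in ball x r, F y =
      ∫⁻ y, ∫⁻ r in Set.Ioi ρ, ENNReal.ofReal r ^ (-s - 1) * (ball x r).indicator F y := by
    rw [← lintegral_lintegral_swap hmeas.aemeasurable]
    refine lintegral_congr fun r => ?_
    rw [lintegral_const_mul _ (hF.indicator measurableSet_ball),
      lintegral_indicator measurableSet_ball]
  rw [hswap, ← lintegral_const_mul' _ _ ENNReal.ofReal_ne_top]
  refine lintegral_mono_ae ?_
  -- the diagonal, where both kernels are infinite when `ρ = 0`, is a null set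
  filter_upwards [Measure.ae_ne volume x] with y hy
  have hxy : 0 < dist x y := dist_pos.2 (Ne.symm hy)
  have hm : 0 < max (dist x y) ρ := lt_max_of_lt_left hxy
  have hsub : Set.Ioi (max (dist x y) ρ) ⊆ Set.Ioi ρ := Set.Ioi_subset_Ioi (le_max_right _ _)
  have hmax : max (edist x y) (ENNReal.ofReal ρ) = ENNReal.ofReal (max (dist x y) ρ) := by
    rw [edist_dist, ENNReal.ofReal_max]
  calc F y * max (edist x y) (ENNReal.ofReal ρ) ^ (-s)
      = ENNReal.ofReal s *
          ∫⁻ r in Set.Ioi (max (dist x y) ρ), ENNReal.ofReal r ^ (-s - 1) * F y := by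
        rw [lintegral_mul_const _ (by fun_prop), lintegral_Ioi_ofReal_rpow hs hm, hmax,
          ← mul_assoc, ENNReal.mul_div_cancel (by simpa using hs) ENNReal.ofReal_ne_top, mul_comm]
    _ = ENNReal.ofReal s * ∫⁻ r in Set.Ioi (max (dist x y) ρ),
          ENNReal.ofReal r ^ (-s - 1) * (ball x r).indicator F y := by
        congr 1
        refine setLIntegral_congr_fun measurableSet_Ioi fun r hr => ?_
        have : y ∈ ball x r := by
          rw [mem_ball, dist_comm]; exact (le_max_left _ _).trans_lt hr
        simp [this]
    _ ≤ _ := by gcongr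

theorem rieszLIntegral_le_lintegral_ball [NeZero d] {α : ℝ} (hα : α < d)
    {F : EuclideanSpace ℝ (Fin d) → ℝ≥0∞} (hF : Measurable F) (x : EuclideanSpace ℝ (Fin d)) :
    rieszLIntegral α F x ≤ ENNReal.ofReal (d - α) *
        ∫⁻ r in Set.Ioi 0, ENNReal.ofReal r ^ (α - d - 1) * ∫⁻ y in ball x r, F y := by
  simpa [rieszLIntegral] using lintegral_mul_max_edist_rpow_le (sub_pos.2 hα) hF x 0

/-- Interpolation between two growth bounds on the mass of balls centred at `x`: the exponents `a`
and `c` lie on either side of `α`, so the bound with `A` controls the contribution of small balls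
and the bound with `D` that of large ones. -/
theorem rieszLIntegral_le_of_ball_le [NeZero d] {α a c : ℝ} (hα : α < d) (ha : a < α) (hc : α < c)
    {F : EuclideanSpace ℝ (Fin d) → ℝ≥0∞} (hF : Measurable F) {x : EuclideanSpace ℝ (Fin d)}
    {A D : ℝ≥0∞} (hA : A ≠ 0) (hD : D ≠ 0) (hD' : D ≠ ∞)
    (h1 : ∀ r : ℝ, 0 < r → ∫⁻ y in ball x r, F y ≤ A * ENNReal.ofReal r ^ (d - a))
    (h2 : ∀ r : ℝ, 0 < r → ∫⁻ y in ball x r, F y ≤ D * ENNReal.ofReal r ^ (d - c)) :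
    rieszLIntegral α F x ≤
      ENNReal.ofReal (d - α) * (1 / ENNReal.ofReal (α - a) + 1 / ENNReal.ofReal (c - α)) *
        (A ^ ((c - α) / (c - a)) * D ^ ((α - a) / (c - a))) := by
  have hca : 0 < c - a := by linarith
  have hαa : 0 < α - a := by linarith
  have hcα : 0 < c - α := by linarith
  have hα' : 0 < d - α := by linarith
  rcases eq_or_ne A ∞ with rfl | hA'
  · rw [ENNReal.top_rpow_of_pos (div_pos hcα hca), ENNReal.top_mul, ENNReal.mul_top]
    · exact le_top
    · simp [hα]
    · exact (ENNReal.rpow_pos hD.bot_lt hD').ne'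
  -- the radius at which the two bounds agree
  set R : ℝ := ((D / A) ^ (1 / (c - a))).toReal with hR
  have hDA : D / A ≠ 0 := ENNReal.div_ne_zero.2 ⟨hD, hA'⟩
  have hDA' : D / A ≠ ∞ := ENNReal.div_ne_top hD' hA
  have hRE : ENNReal.ofReal R = (D / A) ^ (1 / (c - a)) :=
    ENNReal.ofReal_toReal (ENNReal.rpow_ne_top_of_ne_zero hDA hDA')
  have hRpos : 0 < R := by
    rw [← ENNReal.ofReal_pos, hRE]; exact ENNReal.rpow_pos hDA.bot_lt hDA'
  have hpow (t : ℝ) : ENNReal.ofReal R ^ t = D ^ (t / (c - a)) * A ^ (-(t / (c - a))) := by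
    rw [hRE, ← ENNReal.rpow_mul, one_div_mul_eq_div, div_eq_mul_inv D A,
      ENNReal.mul_rpow_of_ne_top hD' (ENNReal.inv_ne_top.2 hA), ENNReal.inv_rpow, ENNReal.rpow_neg]
  have e1 : A * ENNReal.ofReal R ^ (α - a) =
      A ^ ((c - α) / (c - a)) * D ^ ((α - a) / (c - a)) := by
    have : (c - α) / (c - a) = 1 + -((α - a) / (c - a)) := by field_simp; ring
    rw [hpow, this, ENNReal.rpow_add _ _ hA hA', ENNReal.rpow_one]
    ring
  have e2 : D * ENNReal.ofReal R ^ (-(c - α)) =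
      A ^ ((c - α) / (c - a)) * D ^ ((α - a) / (c - a)) := by
    have : (α - a) / (c - a) = 1 + -(c - α) / (c - a) := by field_simp; ring
    rw [hpow, this, ENNReal.rpow_add _ _ hD hD', ENNReal.rpow_one]
    rw [neg_div, neg_neg]
    ring
  refine (rieszLIntegral_le_lintegral_ball hα hF x).trans ?_
  rw [mul_assoc]
  gcongr
  rw [← Set.Ioc_union_Ioi_eq_Ioi hRpos.le]
  refine (lintegral_union_le _ _ _).trans ?_
  rw [add_mul]
  refine add_le_add ?_ ?_
  · calc _ ≤ ∫⁻ r in Set.Ioc 0 R, A * ENNReal.ofReal r ^ (α - a - 1) := by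
          refine setLIntegral_mono' measurableSet_Ioc fun r hr => ?_
          have hr0 : ENNReal.ofReal r ≠ 0 := by simpa using hr.1
          refine (mul_le_mul_right (h1 r hr.1) _).trans_eq ?_
          rw [mul_left_comm, ← ENNReal.rpow_add _ _ hr0 ENNReal.ofReal_ne_top]
          congr 2; ring
      _ = _ := by
          rw [lintegral_const_mul' _ _ hA', lintegral_Ioc_ofReal_rpow hαa hRpos, ← e1,
            ENNReal.div_eq_inv_mul, one_div]
          ring
  · calc _ ≤ ∫⁻ r in Set.Ioi R, D * ENNReal.ofReal r ^ (-(c - α) - 1) := by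
          refine setLIntegral_mono' measurableSet_Ioi fun r hr => ?_
          have hr' : 0 < r := hRpos.trans hr
          have hr0 : ENNReal.ofReal r ≠ 0 := by simpa using hr'
          refine (mul_le_mul_right (h2 r hr') _).trans_eq ?_
          rw [mul_left_comm, ← ENNReal.rpow_add _ _ hr0 ENNReal.ofReal_ne_top]
          congr 2; ring
      _ = _ := by
          rw [lintegral_const_mul' _ _ hD', lintegral_Ioi_ofReal_rpow hcα hRpos, ← e2,
            ENNReal.div_eq_inv_mul, one_div]
          ring

/-! ### Averages of a Riesz potential over balls -/

theorem ENNReal.rpow_neg_le_rpow_neg {x y : ℝ≥0∞} {s : ℝ} (hs : 0 ≤ s) (h : x ≤ y) :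
    y ^ (-s) ≤ x ^ (-s) := by
  rw [ENNReal.rpow_neg, ENNReal.rpow_neg, ENNReal.inv_le_inv]
  exact ENNReal.rpow_le_rpow h hs

theorem volume_ball_eq_rpow_mul (x : EuclideanSpace ℝ (Fin d)) {r : ℝ} (hr : 0 < r) :
    volume (ball x r) =
      volume (ball (0 : EuclideanSpace ℝ (Fin d)) 1) * ENNReal.ofReal r ^ (d : ℝ) := by
  rw [Measure.addHaar_ball_of_pos _ _ hr, finrank_euclideanSpace_fin, ENNReal.rpow_natCast,
    ENNReal.ofReal_pow hr.le, mul_comm]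

theorem exists_lintegral_ball_edist_rpow_le [NeZero d] {γ : ℝ} (hγ : 0 < γ) (hγd : γ < d) :
    ∃ C : ℝ≥0, ∀ (x : EuclideanSpace ℝ (Fin d)) (r : ℝ), 0 < r →
      ∫⁻ y in ball x r, edist x y ^ (γ - d) ≤ C * ENNReal.ofReal r ^ γ := by
  have hd : (0 : ℝ) < d := hγ.trans hγd
  set v := volume (ball (0 : EuclideanSpace ℝ (Fin d)) 1) with hv
  have hv0 : v ≠ 0 := (measure_ball_pos _ _ one_pos).ne'
  have hv1 : v ≠ ∞ := measure_ball_lt_top.ne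
  set K := ENNReal.ofReal (d - γ) *
    (1 / ENNReal.ofReal (γ - 0) + 1 / ENNReal.ofReal (d - γ)) with hK
  have hK' : K ≠ ∞ := by
    refine ENNReal.mul_ne_top ENNReal.ofReal_ne_top (ENNReal.add_ne_top.2 ⟨?_, ?_⟩)
    · exact ENNReal.div_ne_top ENNReal.one_ne_top (by simpa using hγ)
    · exact ENNReal.div_ne_top ENNReal.one_ne_top (by simpa using hγd)
  refine ⟨(K * v).toNNReal, fun x r hr => ?_⟩
  rw [ENNReal.coe_toNNReal (ENNReal.mul_ne_top hK' hv1)]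
  have hr0 : ENNReal.ofReal r ≠ 0 := by simpa using hr
  have hrd0 : ENNReal.ofReal r ^ (d : ℝ) ≠ 0 :=
    (ENNReal.rpow_pos hr0.bot_lt ENNReal.ofReal_ne_top).ne'
  have hrd1 : ENNReal.ofReal r ^ (d : ℝ) ≠ ∞ :=
    ENNReal.rpow_ne_top_of_nonneg hd.le ENNReal.ofReal_ne_top
  -- the potential of the indicator of the ball, evaluated at the centre
  have key := rieszLIntegral_le_of_ball_le (α := γ) (a := 0) (c := d) hγd hγ hγd
    (F := (ball x r).indicator 1) (measurable_one.indicator measurableSet_ball) (x := x)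
    (A := v) (D := v * ENNReal.ofReal r ^ (d : ℝ)) hv0 (mul_ne_zero hv0 hrd0)
    (ENNReal.mul_ne_top hv1 hrd1) (fun t ht => ?_) (fun t ht => ?_)
  · calc _ = rieszLIntegral γ ((ball x r).indicator 1) x := by
          rw [rieszLIntegral, ← lintegral_indicator measurableSet_ball]
          refine lintegral_congr fun y => ?_
          by_cases hy : y ∈ ball x r <;> simp [hy]
      _ ≤ _ := key
      _ = _ := by
          rw [← hK, mul_assoc K v]
          congr 1
          rw [sub_zero, sub_zero, ENNReal.mul_rpow_of_nonneg _ _ (by positivity),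
            ← ENNReal.rpow_mul, mul_div_cancel₀ _ hd.ne', ← mul_assoc,
            ← ENNReal.rpow_add _ _ hv0 hv1, ← add_div, sub_add_cancel, div_self hd.ne',
            ENNReal.rpow_one]
  · rw [sub_zero, ← volume_ball_eq_rpow_mul x ht]
    calc _ ≤ ∫⁻ _ in ball x t, 1 :=
          lintegral_mono fun y => Set.indicator_le_self' (fun _ _ => zero_le) y
      _ = _ := by simp
  · rw [sub_self, ENNReal.rpow_zero, mul_one, ← volume_ball_eq_rpow_mul x hr]
    calc _ ≤ ∫⁻ y, (ball x r).indicator 1 y := setLIntegral_le_lintegral _ _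
      _ = _ := by rw [lintegral_indicator_one measurableSet_ball]

/-- The kernel `edist · y ^ (γ - d)` has the Muckenhoupt `A₁` property, in the stronger form with the
distance truncated at the radius of the ball. -/
theorem exists_lintegral_ball_edist_rpow_le_max [NeZero d] {γ : ℝ} (hγ : 0 < γ) (hγd : γ < d) :
    ∃ C : ℝ≥0, ∀ (x y : EuclideanSpace ℝ (Fin d)) (r : ℝ), 0 < r →
      ∫⁻ z in ball x r, edist z y ^ (γ - d) ≤
        C * ENNReal.ofReal r ^ (d : ℝ) * max (edist x y) (ENNReal.ofReal r) ^ (γ - d) := by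
  obtain ⟨C₀, hC₀⟩ := exists_lintegral_ball_edist_rpow_le (d := d) hγ hγd
  have hs : 0 ≤ d - γ := by linarith
  set v := volume (ball (0 : EuclideanSpace ℝ (Fin d)) 1) with hv
  have hv1 : v ≠ ∞ := measure_ball_lt_top.ne
  set C : ℝ≥0∞ := 2 ^ (d - γ) * (v + C₀ * 3 ^ γ) with hC
  have hC' : C ≠ ∞ := by
    refine ENNReal.mul_ne_top (ENNReal.rpow_ne_top_of_nonneg hs ENNReal.ofNat_ne_top)
      (ENNReal.add_ne_top.2 ⟨hv1, ENNReal.mul_ne_top ENNReal.coe_ne_top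
        (ENNReal.rpow_ne_top_of_nonneg hγ.le ENNReal.ofNat_ne_top)⟩)
  refine ⟨C.toNNReal, fun x y r hr => ?_⟩
  rw [ENNReal.coe_toNNReal hC']
  have hr0 : ENNReal.ofReal r ≠ 0 := by simpa using hr
  set M := max (edist x y) (ENNReal.ofReal r) with hM
  have e1 : γ - d = -(d - γ) := by ring
  have hcmp {t : ℝ≥0∞} (ht : M ≤ 2 * t) : t ^ (γ - d) ≤ 2 ^ (d - γ) * M ^ (γ - d) := by
    have h := ENNReal.rpow_neg_le_rpow_neg hs ht
    have h2 : (2 : ℝ≥0∞) ^ (d - γ) * (2 * t) ^ (-(d - γ)) = t ^ (γ - d) := by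
      rw [ENNReal.rpow_neg, ENNReal.mul_rpow_of_nonneg _ _ hs, e1, ENNReal.rpow_neg,
        ENNReal.mul_inv (.inl (by simp)) (.inl (by simp)), ← mul_assoc,
        ENNReal.mul_inv_cancel (by simp) (by simp), one_mul]
    rw [← h2, e1]
    gcongr
  rcases le_total (2 * ENNReal.ofReal r) (edist x y) with hfar | hnear
  · -- the point `y` is far from the ball: the kernel is almost constant on the ball
    have hz : ∀ z ∈ ball x r, edist z y ^ (γ - d) ≤ 2 ^ (d - γ) * M ^ (γ - d) := by
      intro z hz
      refine hcmp ?_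
      have hrM : ENNReal.ofReal r ≤ edist x y :=
        le_trans (by rw [two_mul]; exact le_self_add) hfar
      rw [hM, max_eq_left hrM]
      have hxz : edist x z ≤ ENNReal.ofReal r := by
        rw [edist_dist, dist_comm]
        exact ENNReal.ofReal_le_ofReal (mem_ball.1 hz).le
      have htri := edist_triangle x z y
      have h1 : edist x y + edist x y ≤ 2 * edist z y + edist x y := by
        calc edist x y + edist x y ≤ (edist x z + edist z y) + (edist x z + edist z y) := by
              gcongr
          _ = 2 * edist z y + 2 * edist x z := by ring
          _ ≤ 2 * edist z y + edist x y := by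
              gcongr
              exact le_trans (by gcongr) hfar
      exact (ENNReal.add_le_add_iff_right (edist_ne_top _ _)).1 h1
    calc _ ≤ ∫⁻ _ in ball x r, 2 ^ (d - γ) * M ^ (γ - d) :=
          setLIntegral_mono' measurableSet_ball hz
      _ = 2 ^ (d - γ) * v * ENNReal.ofReal r ^ (d : ℝ) * M ^ (γ - d) := by
          rw [setLIntegral_const, volume_ball_eq_rpow_mul x hr]; ring
      _ ≤ _ := by rw [hC]; gcongr; exact le_self_add
  · have hsub : ball x r ⊆ ball y (3 * r) := by
      refine ball_subset_ball' ?_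
      have : dist x y ≤ 2 * r := by
        have h : ENNReal.ofReal (dist x y) ≤ ENNReal.ofReal (2 * r) := by
          rwa [ENNReal.ofReal_mul zero_le_two, ENNReal.ofReal_ofNat, ← edist_dist]
        exact (ENNReal.ofReal_le_ofReal_iff (by positivity)).1 h
      linarith
    have hMr : M ≤ 2 * ENNReal.ofReal r :=
      max_le hnear (by rw [two_mul]; exact le_self_add)
    calc _ ≤ ∫⁻ z in ball y (3 * r), edist z y ^ (γ - d) := lintegral_mono_set hsub
      _ ≤ C₀ * ENNReal.ofReal (3 * r) ^ γ := by
          simpa only [edist_comm] using hC₀ y (3 * r) (by positivity)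
      _ = C₀ * 3 ^ γ * ENNReal.ofReal r ^ (d : ℝ) * ENNReal.ofReal r ^ (γ - d) := by
          rw [ENNReal.ofReal_mul (by norm_num), ENNReal.mul_rpow_of_nonneg _ _ hγ.le,
            ENNReal.ofReal_ofNat, mul_assoc _ (_ ^ _) (_ ^ (γ - d)),
            ← ENNReal.rpow_add _ _ hr0 ENNReal.ofReal_ne_top, add_sub_cancel, mul_assoc]
      _ ≤ C₀ * 3 ^ γ * ENNReal.ofReal r ^ (d : ℝ) * (2 ^ (d - γ) * M ^ (γ - d)) := by
          gcongr
          exact hcmp hMr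
      _ = 2 ^ (d - γ) * (C₀ * 3 ^ γ) * ENNReal.ofReal r ^ (d : ℝ) * M ^ (γ - d) := by ring
      _ ≤ _ := by rw [hC]; gcongr; exact le_add_self

theorem exists_lintegral_ball_rieszLIntegral_le_max [NeZero d] {γ : ℝ} (hγ : 0 < γ)
    (hγd : γ < d) :
    ∃ C : ℝ≥0, ∀ F : EuclideanSpace ℝ (Fin d) → ℝ≥0∞, Measurable F →
      ∀ (x : EuclideanSpace ℝ (Fin d)) (r : ℝ), 0 < r →
        ∫⁻ z in ball x r, rieszLIntegral γ F z ≤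
          C * ENNReal.ofReal r ^ (d : ℝ) *
            ∫⁻ y, F y * max (edist x y) (ENNReal.ofReal r) ^ (γ - d) := by
  obtain ⟨C, hC⟩ := exists_lintegral_ball_edist_rpow_le_max (d := d) hγ hγd
  refine ⟨C, fun F hF x r hr => ?_⟩
  have hm : Measurable (Function.uncurry fun z y : EuclideanSpace ℝ (Fin d) =>
      F y * edist z y ^ (γ - d)) :=
    (hF.comp measurable_snd).mul (measurable_edist.pow_const _)
  calc _ = ∫⁻ y, ∫⁻ z in ball x r, F y * edist z y ^ (γ - d) :=
        lintegral_lintegral_swap hm.aemeasurable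
    _ = ∫⁻ y, F y * ∫⁻ z in ball x r, edist z y ^ (γ - d) := by
        refine lintegral_congr fun y => ?_
        rw [lintegral_const_mul _ (by fun_prop)]
    _ ≤ ∫⁻ y, (C * ENNReal.ofReal r ^ (d : ℝ)) *
          (F y * max (edist x y) (ENNReal.ofReal r) ^ (γ - d)) := by
        refine lintegral_mono fun y => (mul_le_mul_right (hC x y r hr) _).trans_eq ?_
        ring
    _ = _ := by
        rw [lintegral_const_mul]
        exact hF.mul ((measurable_edist_right.max measurable_const).pow_const _)

/-- The potential `w` of a nonnegative function is an `A₁` weight: its average over a ball is at most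
a constant times its value at the centre. -/
theorem exists_lintegral_ball_rieszLIntegral_le [NeZero d] {γ : ℝ} (hγ : 0 < γ) (hγd : γ < d) :
    ∃ C : ℝ≥0, ∀ F : EuclideanSpace ℝ (Fin d) → ℝ≥0∞, Measurable F →
      ∀ (x : EuclideanSpace ℝ (Fin d)) (r : ℝ), 0 < r →
        ∫⁻ z in ball x r, rieszLIntegral γ F z ≤
          C * ENNReal.ofReal r ^ (d : ℝ) * rieszLIntegral γ F x := by
  obtain ⟨C, hC⟩ := exists_lintegral_ball_rieszLIntegral_le_max (d := d) hγ hγd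
  refine ⟨C, fun F hF x r hr => (hC F hF x r hr).trans ?_⟩
  have e1 : γ - d = -(d - γ) := by ring
  rw [rieszLIntegral, e1]
  refine mul_le_mul_right (lintegral_mono fun y => mul_le_mul_right ?_ _) _
  exact ENNReal.rpow_neg_le_rpow_neg (by linarith) (le_max_left _ _)

/-- The potential of order `γ` of a function with Morrey exponent `m` has Morrey exponent `m - γ`. -/
theorem exists_lintegral_ball_rieszLIntegral_le_rpow [NeZero d] {γ m : ℝ} (hγ : 0 < γ)
    (hγd : γ < d) (hm : γ < m) :
    ∃ C : ℝ≥0, ∀ F : EuclideanSpace ℝ (Fin d) → ℝ≥0∞, Measurable F →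
      (∀ (x : EuclideanSpace ℝ (Fin d)) (r : ℝ), 0 < r →
        ∫⁻ y in ball x r, F y ≤ ENNReal.ofReal r ^ (d - m)) →
      ∀ (x : EuclideanSpace ℝ (Fin d)) (r : ℝ), 0 < r →
        ∫⁻ z in ball x r, rieszLIntegral γ F z ≤ C * ENNReal.ofReal r ^ (d - (m - γ)) := by
  obtain ⟨C, hC⟩ := exists_lintegral_ball_rieszLIntegral_le_max (d := d) hγ hγd
  refine ⟨C * ((d - γ).toNNReal / (m - γ).toNNReal), fun F hF hball x r hr =>
    (hC F hF x r hr).trans ?_⟩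
  have hr0 : ENNReal.ofReal r ≠ 0 := by simpa using hr
  have hmγ : (m - γ).toNNReal ≠ 0 := by simpa using hm
  have e1 : γ - d = -(d - γ) := by ring
  calc _ ≤ C * ENNReal.ofReal r ^ (d : ℝ) * (ENNReal.ofReal (d - γ) *
        ∫⁻ t in Set.Ioi r, ENNReal.ofReal t ^ (-(d - γ) - 1) * ∫⁻ y in ball x t, F y) := by
        rw [e1]
        gcongr
        exact lintegral_mul_max_edist_rpow_le (by linarith) hF x r
    _ ≤ C * ENNReal.ofReal r ^ (d : ℝ) * (ENNReal.ofReal (d - γ) *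
        ∫⁻ t in Set.Ioi r, ENNReal.ofReal t ^ (-(m - γ) - 1)) := by
        refine mul_le_mul_right (mul_le_mul_right
          (setLIntegral_mono' measurableSet_Ioi fun t ht => ?_) _) _
        have ht' : 0 < t := hr.trans ht
        have ht0 : ENNReal.ofReal t ≠ 0 := by simpa using ht'
        refine (mul_le_mul_right (hball x t ht') _).trans_eq ?_
        rw [← ENNReal.rpow_add _ _ ht0 ENNReal.ofReal_ne_top]
        congr 1; ring
    _ = _ := by
        rw [lintegral_Ioi_ofReal_rpow (by linarith) hr, ENNReal.coe_mul, ENNReal.coe_div hmγ]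
        have e2 : (d : ℝ) - (m - γ) = d + -(m - γ) := by ring
        rw [e2, ENNReal.rpow_add _ _ hr0 ENNReal.ofReal_ne_top]
        simp only [ENNReal.ofReal, div_eq_mul_inv]
        ring

theorem lintegral_ball_le_rieszLIntegral {γ : ℝ} (hγd : γ < d)
    {F : EuclideanSpace ℝ (Fin d) → ℝ≥0∞}
    (x : EuclideanSpace ℝ (Fin d)) {r : ℝ} (hr : 0 < r) :
    ∫⁻ y in ball x r, F y ≤ ENNReal.ofReal r ^ (d - γ) * rieszLIntegral γ F x := by
  have hr0 : ENNReal.ofReal r ≠ 0 := by simpa using hr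
  have e1 : γ - d = -(d - γ) := by ring
  calc _ ≤ ∫⁻ y in ball x r, ENNReal.ofReal r ^ (d - γ) * (F y * edist x y ^ (γ - d)) := by
        refine setLIntegral_mono' measurableSet_ball fun y hy => ?_
        have hxy : edist x y ≤ ENNReal.ofReal r := by
          rw [edist_dist, dist_comm]
          exact ENNReal.ofReal_le_ofReal (mem_ball.1 hy).le
        calc F y = ENNReal.ofReal r ^ (d - γ) * (F y * ENNReal.ofReal r ^ (γ - d)) := by
              rw [mul_left_comm, ← ENNReal.rpow_add _ _ hr0 ENNReal.ofReal_ne_top]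
              simp
          _ ≤ _ := by
              refine mul_le_mul_right (mul_le_mul_right ?_ _) _
              rw [e1]
              exact ENNReal.rpow_neg_le_rpow_neg (by linarith) hxy
    _ ≤ ∫⁻ y, ENNReal.ofReal r ^ (d - γ) * (F y * edist x y ^ (γ - d)) :=
        setLIntegral_le_lintegral _ _
    _ = _ := by
        rw [lintegral_const_mul' _ _ (ENNReal.rpow_ne_top_of_nonneg (by linarith)
          ENNReal.ofReal_ne_top)]
        rfl

/-! ### Potentials of products of powers -/

/-- Hölder's inequality with three factors, one of them constant. -/
theorem lintegral_rpow_mul_rpow_le {X : Type*} [MeasurableSpace X] {μ : Measure X}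
    {f g : X → ℝ≥0∞} (hf : Measurable f) (hg : Measurable g) {s e : ℝ} (hs : 0 ≤ s) (he : 0 ≤ e)
    (hse : s + e ≤ 1) :
    ∫⁻ x, f x ^ s * g x ^ e ∂μ ≤
      μ Set.univ ^ (1 - s - e) * (∫⁻ x, f x ∂μ) ^ s * (∫⁻ x, g x ∂μ) ^ e := by
  have h := ENNReal.lintegral_prod_norm_pow_le (μ := μ) (Finset.univ : Finset (Fin 3))
    (f := ![fun _ => 1, f, g]) (p := ![1 - s - e, s, e])
    (by intro i _; fin_cases i <;> simp [hf.aemeasurable, hg.aemeasurable])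
    (by simp [Fin.sum_univ_three]; ring)
    (by intro i _; fin_cases i <;> simp [hs, he]; linarith)
  simpa [Fin.prod_univ_three] using h

/-- For `w` the potential of order `γ` of `F`, the potential of order `α` of `F ^ s * w ^ e` is
bounded by the power of `w` that scaling dictates, `F` and `w` being homogeneous of degrees `-m` and
`-(m - γ)`. -/
theorem exists_rieszLIntegral_rpow_mul_rpow_le [NeZero d] {α γ m s e : ℝ} (hα : α < d)
    (hγ : 0 < γ) (hγd : γ < d) (hγm : γ < m) (hs : 0 ≤ s) (he : 0 ≤ e) (hse : 0 < s + e)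
    (hse' : s + e ≤ 1) (hlow : γ * s < α) (hhigh : α < m * s + (m - γ) * e) :
    ∃ C : ℝ≥0, ∀ F : EuclideanSpace ℝ (Fin d) → ℝ≥0∞, Measurable F →
      (∀ (x : EuclideanSpace ℝ (Fin d)) (r : ℝ), 0 < r →
        ∫⁻ y in ball x r, F y ≤ ENNReal.ofReal r ^ (d - m)) →
      ∀ x : EuclideanSpace ℝ (Fin d), rieszLIntegral γ F x ≠ 0 →
        rieszLIntegral α (fun y => F y ^ s * rieszLIntegral γ F y ^ e) x ≤
          C * rieszLIntegral γ F x ^ ((m * s + (m - γ) * e - α) / (m - γ)) := by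
  obtain ⟨C₁, hC₁⟩ := exists_lintegral_ball_rieszLIntegral_le (d := d) hγ hγd
  obtain ⟨C₂, hC₂⟩ := exists_lintegral_ball_rieszLIntegral_le_rpow (d := d) hγ hγd hγm
  set v := volume (ball (0 : EuclideanSpace ℝ (Fin d)) 1) with hv
  have hv0 : v ≠ 0 := (measure_ball_pos _ _ one_pos).ne'
  have hv1 : v ≠ ∞ := measure_ball_lt_top.ne
  set L : ℝ≥0∞ := C₁ + C₂ + 1 with hL
  have hL1 : (C₁ : ℝ≥0∞) ≤ L := by rw [hL, add_assoc]; exact le_self_add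
  have hL2 : (C₂ : ℝ≥0∞) ≤ L := by rw [hL, add_right_comm]; exact le_add_self
  have hL0 : L ≠ 0 := by simp [hL]
  have hL' : L ≠ ∞ := by simp [hL]
  have ht : 0 ≤ 1 - s - e := by linarith
  set K : ℝ≥0∞ := v ^ (1 - s - e) * L ^ e with hK
  have hK0 : K ≠ 0 := mul_ne_zero (ENNReal.rpow_pos hv0.bot_lt hv1).ne'
    (ENNReal.rpow_pos hL0.bot_lt hL').ne'
  have hK' : K ≠ ∞ := ENNReal.mul_ne_top (ENNReal.rpow_ne_top_of_nonneg ht hv1)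
    (ENNReal.rpow_ne_top_of_nonneg he hL')
  have hκ : 0 < m - γ := by linarith
  have hca : m * s + (m - γ) * e - γ * s = (m - γ) * (s + e) := by ring
  have hca0 : (m - γ) * (s + e) ≠ 0 := by positivity
  set K₁ : ℝ≥0∞ := ENNReal.ofReal (d - α) * (1 / ENNReal.ofReal (α - γ * s) +
    1 / ENNReal.ofReal (m * s + (m - γ) * e - α)) with hK₁
  have hK₁' : K₁ ≠ ∞ := by
    refine ENNReal.mul_ne_top ENNReal.ofReal_ne_top (ENNReal.add_ne_top.2 ⟨?_, ?_⟩)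
    · exact ENNReal.div_ne_top ENNReal.one_ne_top (by simpa using hlow)
    · exact ENNReal.div_ne_top ENNReal.one_ne_top (by simpa using hhigh)
  refine ⟨(K₁ * K).toNNReal, fun F hF hball x hx => ?_⟩
  rw [ENNReal.coe_toNNReal (ENNReal.mul_ne_top hK₁' hK')]
  set w := rieszLIntegral γ F with hw
  have hwm : Measurable w := measurable_rieszLIntegral hF
  have hholder (r : ℝ) (hr : 0 < r) : ∫⁻ y in ball x r, F y ^ s * w y ^ e ≤
      (v * ENNReal.ofReal r ^ (d : ℝ)) ^ (1 - s - e) * (∫⁻ y in ball x r, F y) ^ s *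
        (∫⁻ y in ball x r, w y) ^ e := by
    have h := lintegral_rpow_mul_rpow_le (μ := volume.restrict (ball x r)) hF hwm hs he hse'
    rwa [Measure.restrict_apply_univ, volume_ball_eq_rpow_mul x hr] at h
  have key := rieszLIntegral_le_of_ball_le (α := α) (a := γ * s) (c := m * s + (m - γ) * e)
    hα hlow hhigh (F := fun y => F y ^ s * w y ^ e)
    ((hF.pow_const _).mul (hwm.pow_const _)) (x := x)
    (A := K * w x ^ (s + e)) (D := K)
    (mul_ne_zero hK0 (ENNReal.rpow_pos_of_nonneg hx.bot_lt hse.le).ne') hK0 hK'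
    (fun r hr => ?_) (fun r hr => ?_)
  · refine key.trans_eq ?_
    rw [← hK₁, ENNReal.mul_rpow_of_nonneg _ _ (by rw [hca]; apply div_nonneg <;> nlinarith),
      ← ENNReal.rpow_mul, mul_right_comm (K ^ _), ← ENNReal.rpow_add _ _ hK0 hK', ← add_div,
      sub_add_sub_cancel, hca, div_self hca0, ENNReal.rpow_one, ← mul_assoc]
    congr 2
    have := hse.ne'
    field_simp
  · have hr0 : ENNReal.ofReal r ≠ 0 := by simpa using hr
    calc _ ≤ (v * ENNReal.ofReal r ^ (d : ℝ)) ^ (1 - s - e) *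
          (ENNReal.ofReal r ^ (d - γ) * w x) ^ s *
          (L * ENNReal.ofReal r ^ (d : ℝ) * w x) ^ e := by
          refine (hholder r hr).trans ?_
          gcongr
          · exact lintegral_ball_le_rieszLIntegral hγd x hr
          · exact (hC₁ F hF x r hr).trans (by gcongr)
      _ = K * (w x ^ s * w x ^ e) * (ENNReal.ofReal r ^ (d * (1 - s - e)) *
            ENNReal.ofReal r ^ ((d - γ) * s) * ENNReal.ofReal r ^ (d * e)) := by
          simp only [ENNReal.mul_rpow_of_nonneg _ _ ht, ENNReal.mul_rpow_of_nonneg _ _ hs,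
            ENNReal.mul_rpow_of_nonneg _ _ he, ← ENNReal.rpow_mul, hK]
          ring
      _ = _ := by
          rw [← ENNReal.rpow_add _ _ hr0 ENNReal.ofReal_ne_top,
            ← ENNReal.rpow_add _ _ hr0 ENNReal.ofReal_ne_top,
            ← ENNReal.rpow_add_of_nonneg _ _ hs he]
          congr 2
          ring
  · have hr0 : ENNReal.ofReal r ≠ 0 := by simpa using hr
    calc _ ≤ (v * ENNReal.ofReal r ^ (d : ℝ)) ^ (1 - s - e) *
          (ENNReal.ofReal r ^ (d - m)) ^ s *
          (L * ENNReal.ofReal r ^ (d - (m - γ))) ^ e := by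
          refine (hholder r hr).trans ?_
          gcongr
          · exact hball x r hr
          · exact (hC₂ F hF hball x r hr).trans (by gcongr)
      _ = K * (ENNReal.ofReal r ^ (d * (1 - s - e)) *
            ENNReal.ofReal r ^ ((d - m) * s) * ENNReal.ofReal r ^ ((d - (m - γ)) * e)) := by
          simp only [ENNReal.mul_rpow_of_nonneg _ _ ht,
            ENNReal.mul_rpow_of_nonneg _ _ he, ← ENNReal.rpow_mul, hK]
          ring
      _ = _ := by
          rw [← ENNReal.rpow_add _ _ hr0 ENNReal.ofReal_ne_top,
            ← ENNReal.rpow_add _ _ hr0 ENNReal.ofReal_ne_top]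
          congr 2
          ring

/-! ### Schur's test -/

/-- **Schur's test** for a nonnegative kernel `k` on `L_p`, with weight `g` on the target side and
test function `H`. -/
theorem lintegral_mul_rpow_le_of_schur {X : Type*} [MeasurableSpace X] {μ : Measure X} [SFinite μ]
    {k : X → X → ℝ≥0∞} (hk : Measurable (Function.uncurry k)) {f g G H : X → ℝ≥0∞}
    (hf : Measurable f) (hg : Measurable g) (hG : Measurable G) (hH : Measurable H)
    {p : ℝ} (hp : 1 < p) {C : ℝ≥0∞} (hH0 : ∀ᵐ x ∂μ, H x ≠ 0) (hH' : ∀ᵐ x ∂μ, H x ≠ ∞)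
    (h1 : ∀ x, ∫⁻ y, H y * k x y ∂μ ≤ G x)
    (h2 : ∀ y, ∫⁻ x, g x * G x ^ (p - 1) * k x y ∂μ ≤ C * H y ^ (p - 1)) :
    ∫⁻ x, g x * (∫⁻ y, f y * k x y ∂μ) ^ p ∂μ ≤ C * ∫⁻ y, f y ^ p ∂μ := by
  have hp0 : 0 < p := by linarith
  have hp1 : 0 ≤ 1 - 1 / p := by
    rw [sub_nonneg, div_le_one hp0]; exact hp.le
  have hp2 : 0 ≤ 1 / p := by positivity
  have hkx (x : X) : Measurable (k x) := hk.of_uncurry_left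
  have hky (y : X) : Measurable fun x => k x y := hk.of_uncurry_right
  -- Hölder's inequality, with `f * k` written as
  -- `(H * k) ^ (1 - 1/p) * (H ^ (1 - p) * f ^ p * k) ^ (1/p)`
  have hpt (x : X) : (∫⁻ y, f y * k x y ∂μ) ^ p ≤
      G x ^ (p - 1) * ∫⁻ y, H y ^ (1 - p) * f y ^ p * k x y ∂μ := by
    have h : ∫⁻ y, f y * k x y ∂μ = ∫⁻ y, (H y * k x y) ^ (1 - 1 / p) *
        (H y ^ (1 - p) * f y ^ p * k x y) ^ (1 / p) ∂μ := by
      refine lintegral_congr_ae ?_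
      filter_upwards [hH0, hH'] with y hy0 hy1
      have e1 : H y ^ (1 - 1 / p) * H y ^ ((1 - p) * (1 / p)) = 1 := by
        rw [← ENNReal.rpow_add _ _ hy0 hy1]
        have : 1 - 1 / p + (1 - p) * (1 / p) = 0 := by field_simp; ring
        rw [this, ENNReal.rpow_zero]
      have e2 : k x y ^ (1 - 1 / p) * k x y ^ (1 / p) = k x y := by
        rw [← ENNReal.rpow_add_of_nonneg _ _ hp1 hp2, sub_add_cancel, ENNReal.rpow_one]
      have e3 : (f y ^ p) ^ (1 / p) = f y := by
        rw [← ENNReal.rpow_mul, mul_one_div_cancel hp0.ne', ENNReal.rpow_one]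
      rw [ENNReal.mul_rpow_of_nonneg _ _ hp1, ENNReal.mul_rpow_of_nonneg _ _ hp2,
        ENNReal.mul_rpow_of_nonneg _ _ hp2, e3, ← ENNReal.rpow_mul]
      calc f y * k x y = (H y ^ (1 - 1 / p) * H y ^ ((1 - p) * (1 / p))) * f y *
            (k x y ^ (1 - 1 / p) * k x y ^ (1 / p)) := by rw [e1, e2, one_mul]
        _ = _ := by ring
    rw [h]
    have hm1 : Measurable fun y => H y * k x y := hH.mul (hkx x)
    have hm2 : Measurable fun y => H y ^ (1 - p) * f y ^ p * k x y :=
      ((hH.pow_const _).mul (hf.pow_const _)).mul (hkx x)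
    calc _ ≤ ((∫⁻ y, H y * k x y ∂μ) ^ (1 - 1 / p) *
          (∫⁻ y, H y ^ (1 - p) * f y ^ p * k x y ∂μ) ^ (1 / p)) ^ p := by
          gcongr
          exact ENNReal.lintegral_mul_norm_pow_le hm1.aemeasurable hm2.aemeasurable hp1 hp2
            (sub_add_cancel _ _)
      _ = (∫⁻ y, H y * k x y ∂μ) ^ (p - 1) * ∫⁻ y, H y ^ (1 - p) * f y ^ p * k x y ∂μ := by
          rw [ENNReal.mul_rpow_of_nonneg _ _ hp0.le, ← ENNReal.rpow_mul, ← ENNReal.rpow_mul,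
            one_div_mul_cancel hp0.ne', ENNReal.rpow_one, sub_mul, one_mul,
            one_div_mul_cancel hp0.ne']
      _ ≤ _ := by
          gcongr
          exact h1 x
  have hm : Measurable (Function.uncurry fun x y =>
      g x * G x ^ (p - 1) * (H y ^ (1 - p) * f y ^ p * k x y)) := by
    refine Measurable.mul ?_ (Measurable.mul ?_ hk)
    · exact (hg.mul (hG.pow_const _)).comp measurable_fst
    · exact ((hH.pow_const _).mul (hf.pow_const _)).comp measurable_snd
  calc _ ≤ ∫⁻ x, ∫⁻ y, g x * G x ^ (p - 1) * (H y ^ (1 - p) * f y ^ p * k x y) ∂μ ∂μ := by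
        refine lintegral_mono fun x => (mul_le_mul_right (hpt x) _).trans_eq ?_
        have := hkx x
        rw [lintegral_const_mul _ (by fun_prop), mul_assoc]
    _ = ∫⁻ y, ∫⁻ x, g x * G x ^ (p - 1) * (H y ^ (1 - p) * f y ^ p * k x y) ∂μ ∂μ :=
        lintegral_lintegral_swap hm.aemeasurable
    _ = ∫⁻ y, H y ^ (1 - p) * f y ^ p * ∫⁻ x, g x * G x ^ (p - 1) * k x y ∂μ ∂μ := by
        refine lintegral_congr fun y => ?_
        have := hky y
        rw [← lintegral_const_mul _ (by fun_prop)]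
        refine lintegral_congr fun x => ?_
        ring
    _ ≤ ∫⁻ y, C * f y ^ p ∂μ := by
        refine lintegral_mono_ae ?_
        filter_upwards [hH0, hH'] with y hy0 hy1
        calc _ ≤ H y ^ (1 - p) * f y ^ p * (C * H y ^ (p - 1)) := by gcongr; exact h2 y
          _ = H y ^ (1 - p) * H y ^ (p - 1) * (C * f y ^ p) := by ring
          _ = _ := by
              rw [← ENNReal.rpow_add _ _ hy0 hy1, sub_add_sub_cancel, sub_self,
                ENNReal.rpow_zero, one_mul]
    _ = _ := lintegral_const_mul _ (hf.pow_const _)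

/-! ### The normalised inequality -/

theorem rieszLIntegral_ne_zero {γ : ℝ} (hγd : γ < d) {F : EuclideanSpace ℝ (Fin d) → ℝ≥0∞}
    (hF : Measurable F) (hF0 : ¬ F =ᵐ[volume] 0) (x : EuclideanSpace ℝ (Fin d)) :
    rieszLIntegral γ F x ≠ 0 := by
  contrapose! hF0
  rw [rieszLIntegral, lintegral_eq_zero_iff (by fun_prop)] at hF0
  filter_upwards [hF0] with y hy
  refine (mul_eq_zero.1 hy).resolve_right fun h => ?_
  rcases ENNReal.rpow_eq_zero_iff.1 h with h | h
  · linarith [h.2]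
  · exact edist_ne_top _ _ h.1

theorem ae_of_forall_ae_restrict_ball {P : EuclideanSpace ℝ (Fin d) → Prop}
    (h : ∀ r : ℝ, 0 < r → ∀ᵐ x ∂volume.restrict (ball (0 : EuclideanSpace ℝ (Fin d)) r), P x) :
    ∀ᵐ x, P x := by
  rw [← Measure.restrict_univ (μ := (volume : Measure (EuclideanSpace ℝ (Fin d)))),
    ← iUnion_ball_nat_succ (0 : EuclideanSpace ℝ (Fin d)), ae_restrict_iUnion_iff]
  exact fun n => h _ (by positivity)

theorem ae_rieszLIntegral_ne_top [NeZero d] {γ m : ℝ} (hγ : 0 < γ) (hγd : γ < d) (hγm : γ < m)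
    {F : EuclideanSpace ℝ (Fin d) → ℝ≥0∞} (hF : Measurable F)
    (hball : ∀ (x : EuclideanSpace ℝ (Fin d)) (r : ℝ), 0 < r →
        ∫⁻ y in ball x r, F y ≤ ENNReal.ofReal r ^ (d - m)) :
    ∀ᵐ x, rieszLIntegral γ F x ≠ ∞ := by
  obtain ⟨C, hC⟩ := exists_lintegral_ball_rieszLIntegral_le_rpow (d := d) hγ hγd hγm
  refine ae_of_forall_ae_restrict_ball fun r hr => ?_
  have hlt : ∫⁻ z in ball 0 r, rieszLIntegral γ F z ≠ ∞ :=
    ((hC F hF hball 0 r hr).trans_lt (ENNReal.mul_lt_top ENNReal.coe_lt_top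
      (ENNReal.rpow_ne_top_of_ne_zero (by simpa using hr) ENNReal.ofReal_ne_top).lt_top)).ne
  filter_upwards [ae_lt_top (measurable_rieszLIntegral hF) hlt] with x hx using hx.ne

/-- Adams' inequality in normalised form, with `F` in the role of `|b| ^ q`. -/
theorem exists_lintegral_rpow_mul_rieszLIntegral_rpow_le [NeZero d] {α p q : ℝ} (hα : 0 < α)
    (hαd : α < d) (hp : 1 < p) (hpq : p < q) :
    ∃ C : ℝ≥0, ∀ F f : EuclideanSpace ℝ (Fin d) → ℝ≥0∞, Measurable F → Measurable f →
      (∀ (x : EuclideanSpace ℝ (Fin d)) (r : ℝ), 0 < r →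
        ∫⁻ y in ball x r, F y ≤ ENNReal.ofReal r ^ (d - α * q)) →
      ∫⁻ x, F x ^ (p / q) * rieszLIntegral α f x ^ p ≤ C * ∫⁻ x, f x ^ p := by
  have hq0 : 0 < q := by linarith
  have hp1 : 0 < p - 1 := by linarith
  -- `α * u` is the order of the auxiliary potential and `-α * ν` its degree of homogeneity; with
  -- `u = 1 - 1 / q` the requirement `1 < ν`, which leaves room for `η`, becomes `2 < q + 1 / q`
  set u : ℝ := 1 - 1 / q with hu
  have hqi : 1 / q < 1 := by rw [div_lt_one hq0]; linarith
  have hqi0 : 0 < 1 / q := by positivity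
  have hu0 : 0 < u := by linarith
  have hu1 : u < 1 := by linarith
  set ν : ℝ := q - u with hν
  have hν1 : 1 < ν := by
    have : 2 < q + 1 / q := by
      rw [← sub_pos]
      have : q + 1 / q - 2 = (q - 1) ^ 2 / q := by field_simp; ring
      rw [this]
      have : 0 < q - 1 := by linarith
      positivity
    rw [hν, hu]; linarith
  have hγ : 0 < α * u := by positivity
  have hγd : α * u < d := by nlinarith
  have hκ : α * q - α * u = α * ν := by rw [hν]; ring
  have hγm : α * u < α * q := by nlinarith
  have hpq1 : p / q < 1 := by rw [div_lt_one hq0]; exact hpq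
  have hpq0 : 0 < p / q := by positivity
  -- a small surplus, so that both Hölder exponents below stay at most one
  set η : ℝ := min (1 - 1 / ν) ((1 - p / q) / (p - 1)) with hη
  have hνi : 1 / ν < 1 := by rw [div_lt_one (by linarith)]; exact hν1
  have hνi0 : 0 < 1 / ν := by positivity
  have hη0 : 0 < η := lt_min (by linarith) (div_pos (by linarith) hp1)
  have hη1 : η ≤ 1 - 1 / ν := min_le_left _ _
  have hη2 : η * (p - 1) ≤ 1 - p / q := by
    rw [← le_div_iff₀ hp1]; exact min_le_right _ _
  set h : ℝ := 1 / ν + η with hh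
  have hαν : 0 < α * ν := by positivity
  have hνh : ν * h = 1 + ν * η := by rw [hh]; field_simp
  have hνη : 0 < ν * η := by positivity
  obtain ⟨C₁, hC₁⟩ := exists_rieszLIntegral_rpow_mul_rpow_le (d := d) (s := 0) (e := h)
    hαd hγ hγd hγm le_rfl (by positivity) (by positivity) (by linarith) (by linarith)
    (by rw [hκ]; nlinarith)
  obtain ⟨C₂, hC₂⟩ := exists_rieszLIntegral_rpow_mul_rpow_le (d := d) (s := p / q)
    (e := η * (p - 1)) hαd hγ hγd hγm hpq0.le (by positivity) (by positivity) (by linarith)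
    (by nlinarith)
    (by
      have e1 : α * q * (p / q) = α * p := by field_simp
      rw [hκ, e1]
      have : 0 < α * ν * (η * (p - 1)) := by positivity
      nlinarith)
  refine ⟨C₁ ^ (p - 1) * C₂, fun F f hF hf hball => ?_⟩
  by_cases hF0 : F =ᵐ[volume] 0
  · refine le_of_eq_of_le ?_ zero_le
    rw [lintegral_eq_zero_iff (by have := measurable_rieszLIntegral (α := α) hf; fun_prop)]
    filter_upwards [hF0] with x hx
    simp [hx, hpq0]
  set w := rieszLIntegral (α * u) F with hw
  have hwm : Measurable w := measurable_rieszLIntegral hF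
  have hw0 (x) : w x ≠ 0 := rieszLIntegral_ne_zero hγd hF hF0 x
  have hw' : ∀ᵐ x, w x ≠ ∞ := ae_rieszLIntegral_ne_top hγ hγd hγm hF hball
  have hh0 : 0 < h := by positivity
  refine lintegral_mul_rpow_le_of_schur (k := fun x y : EuclideanSpace ℝ (Fin d) =>
    edist x y ^ (α - d)) (g := fun x => F x ^ (p / q)) (G := fun x => C₁ * w x ^ η)
    (H := fun x => w x ^ h) (measurable_edist.pow_const _) hf (by fun_prop) (by fun_prop)
    (by fun_prop) hp ?_ ?_ ?_ ?_
  · exact .of_forall fun x => (ENNReal.rpow_pos_of_nonneg (hw0 x).bot_lt hh0.le).ne'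
  · filter_upwards [hw'] with x hx using ENNReal.rpow_ne_top_of_nonneg hh0.le hx
  · intro x
    have := hC₁ F hF hball x (hw0 x)
    have e1 : (α * q * 0 + (α * q - α * u) * h - α) / (α * q - α * u) = η := by
      rw [hκ, div_eq_iff hαν.ne', mul_assoc α ν h, hνh]; ring
    rw [e1] at this
    simp only [ENNReal.rpow_zero, one_mul] at this
    exact this
  · intro y
    have := hC₂ F hF hball y (hw0 y)
    have e1 : (α * q * (p / q) + (α * q - α * u) * (η * (p - 1)) - α) / (α * q - α * u) =
        h * (p - 1) := by
      have e2 : α * q * (p / q) = α * p := by field_simp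
      rw [hκ, e2, div_eq_iff hαν.ne']
      linear_combination (-(α * (p - 1))) * hνh
    rw [e1] at this
    calc _ = ∫⁻ x, (C₁ : ℝ≥0∞) ^ (p - 1) *
          (F x ^ (p / q) * w x ^ (η * (p - 1)) * edist y x ^ (α - d)) := by
          refine lintegral_congr fun x => ?_
          rw [ENNReal.mul_rpow_of_nonneg _ _ hp1.le, ← ENNReal.rpow_mul, edist_comm]
          ring
      _ = (C₁ : ℝ≥0∞) ^ (p - 1) *
          rieszLIntegral α (fun x => F x ^ (p / q) * w x ^ (η * (p - 1))) y := by
          rw [rieszLIntegral, lintegral_const_mul]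
          exact ((hF.pow_const _).mul (hwm.pow_const _)).mul
            (measurable_edist_right.pow_const _)
      _ ≤ (C₁ : ℝ≥0∞) ^ (p - 1) * (C₂ * w y ^ (h * (p - 1))) := by gcongr
      _ = _ := by
          rw [ENNReal.rpow_mul, ENNReal.coe_mul, ENNReal.coe_rpow_of_nonneg _ hp1.le, mul_assoc]

/-! ### From the Morrey norm to the mass of balls -/

theorem lintegral_ball_enorm_rpow_le_morreyENorm {q β : ℝ} (hq : 0 < q)
    (b : EuclideanSpace ℝ (Fin d) → ℝ) (x : EuclideanSpace ℝ (Fin d)) {r : ℝ} (hr : 0 < r) :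
    ∫⁻ y in ball x r, ‖b y‖ₑ ^ q ≤
      volume (ball (0 : EuclideanSpace ℝ (Fin d)) 1) * morreyENorm q β b ^ q *
        ENNReal.ofReal r ^ (d - β * q) := by
  have hr0 : ENNReal.ofReal r ≠ 0 := by simpa using hr
  set B := morreyENorm q β b with hB
  have h1 : ENNReal.ofReal r ^ β * avgLpENorm q (ball x r) b ≤ B := by
    rw [ENNReal.ofReal_rpow_of_pos hr, hB, morreyENorm]
    refine le_trans ?_ (le_iSup₂_of_le r hr le_rfl)
    gcongr
    exact le_iSup (fun x => avgLpENorm q (ball x r) b) x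
  have h2 : avgLpENorm q (ball x r) b ≤ B * ENNReal.ofReal r ^ (-β) := by
    calc _ = ENNReal.ofReal r ^ β * avgLpENorm q (ball x r) b * ENNReal.ofReal r ^ (-β) := by
          rw [mul_right_comm, ← ENNReal.rpow_add _ _ hr0 ENNReal.ofReal_ne_top]
          simp
      _ ≤ _ := by gcongr
  have h3 : ⨍⁻ y in ball x r, ‖b y‖ₑ ^ q ∂volume ≤ (B * ENNReal.ofReal r ^ (-β)) ^ q := by
    calc _ = avgLpENorm q (ball x r) b ^ q := by
          rw [avgLpENorm, ← ENNReal.rpow_mul, one_div_mul_cancel hq.ne', ENNReal.rpow_one]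
      _ ≤ _ := by gcongr
  calc _ = volume (ball x r) * ⨍⁻ y in ball x r, ‖b y‖ₑ ^ q ∂volume :=
        (measure_mul_setLAverage _ measure_ball_lt_top.ne).symm
    _ ≤ volume (ball (0 : EuclideanSpace ℝ (Fin d)) 1) * ENNReal.ofReal r ^ (d : ℝ) *
          (B * ENNReal.ofReal r ^ (-β)) ^ q := by
        rw [volume_ball_eq_rpow_mul x hr]; gcongr
    _ = volume (ball (0 : EuclideanSpace ℝ (Fin d)) 1) * B ^ q *
          (ENNReal.ofReal r ^ (d : ℝ) * ENNReal.ofReal r ^ (-β * q)) := by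
        rw [ENNReal.mul_rpow_of_nonneg _ _ hq.le, ← ENNReal.rpow_mul]; ring
    _ = _ := by
        rw [← ENNReal.rpow_add _ _ hr0 ENNReal.ofReal_ne_top]
        congr 2; ring

theorem ae_eq_zero_of_morreyENorm_eq_zero {q β : ℝ} (hq : 0 < q)
    {b : EuclideanSpace ℝ (Fin d) → ℝ} (hb : AEStronglyMeasurable b volume)
    (h : morreyENorm q β b = 0) : b =ᵐ[volume] 0 := by
  refine ae_of_forall_ae_restrict_ball fun r hr => ?_
  have h0 := lintegral_ball_enorm_rpow_le_morreyENorm (β := β) hq b 0 hr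
  rw [h, ENNReal.zero_rpow_of_pos hq, mul_zero, zero_mul, nonpos_iff_eq_zero,
    lintegral_eq_zero_iff' (hb.restrict.enorm.pow_const _)] at h0
  filter_upwards [h0] with x hx
  simpa [hq, hq.not_gt] using hx

/-- Adams' inequality for nonnegative `f`, with the potential allowed to take the value `∞`. -/
theorem exists_lintegral_enorm_mul_rieszLIntegral_rpow_le [NeZero d] {α p q : ℝ} (hα : 0 < α)
    (hαd : α < d) (hp : 1 < p) (hpq : p < q) :
    ∃ N : ℝ≥0, ∀ b : EuclideanSpace ℝ (Fin d) → ℝ, MemMorrey q α b →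
      ∀ f : EuclideanSpace ℝ (Fin d) → ℝ≥0∞, AEMeasurable f volume →
        ∫⁻ x, (‖b x‖ₑ * rieszLIntegral α f x) ^ p ≤
          (N * morreyENorm q α b) ^ p * ∫⁻ x, f x ^ p := by
  have hp0 : 0 < p := by linarith
  have hq0 : 0 < q := by linarith
  have hpq0 : 0 < p / q := by positivity
  obtain ⟨C, hC⟩ := exists_lintegral_rpow_mul_rieszLIntegral_rpow_le (d := d) hα hαd hp hpq
  set v := volume (ball (0 : EuclideanSpace ℝ (Fin d)) 1) with hv
  have hv0 : v ≠ 0 := (measure_ball_pos _ _ one_pos).ne'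
  have hv1 : v ≠ ∞ := measure_ball_lt_top.ne
  have hN : (C : ℝ≥0∞) ^ (1 / p) * v ^ (1 / q) ≠ ∞ := ENNReal.mul_ne_top
    (ENNReal.rpow_ne_top_of_nonneg (by positivity) ENNReal.coe_ne_top)
    (ENNReal.rpow_ne_top_of_nonneg (by positivity) hv1)
  refine ⟨((C : ℝ≥0∞) ^ (1 / p) * v ^ (1 / q)).toNNReal, fun b hb f hf => ?_⟩
  rw [ENNReal.coe_toNNReal hN]
  set B := morreyENorm q α b with hB
  have hB' : B ≠ ∞ := hb.2.ne
  rcases eq_or_ne B 0 with hB0 | hB0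
  · refine le_of_eq_of_le ?_ zero_le
    have hb0 := ae_eq_zero_of_morreyENorm_eq_zero hq0 hb.1 hB0
    rw [← lintegral_zero]
    refine lintegral_congr_ae ?_
    filter_upwards [hb0] with x hx
    simp [hx, hp0]
  -- normalisation of `|b| ^ q`
  set D : ℝ≥0∞ := v * B ^ q with hD
  have hD0 : D ≠ 0 := mul_ne_zero hv0 (ENNReal.rpow_pos hB0.bot_lt hB').ne'
  have hD' : D ≠ ∞ := ENNReal.mul_ne_top hv1 (ENNReal.rpow_ne_top_of_nonneg hq0.le hB')
  set b' := hb.1.mk b with hb'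
  have hbb' : b =ᵐ[volume] b' := hb.1.ae_eq_mk
  have hb'm : Measurable b' := hb.1.stronglyMeasurable_mk.measurable
  set f' := hf.mk f with hf'
  have hff' : f =ᵐ[volume] f' := hf.ae_eq_mk
  have hpot : rieszLIntegral α f = rieszLIntegral α f' := by
    funext x
    refine lintegral_congr_ae ?_
    filter_upwards [hff'] with y hy
    rw [hy]
  have key := hC (fun x => D⁻¹ * ‖b' x‖ₑ ^ q) f' (by fun_prop) hf.measurable_mk
    (fun x r hr => by
      rw [lintegral_const_mul _ (by fun_prop)]
      have h : ∫⁻ y in ball x r, ‖b' y‖ₑ ^ q = ∫⁻ y in ball x r, ‖b y‖ₑ ^ q := by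
        refine lintegral_congr_ae ?_
        filter_upwards [ae_restrict_of_ae hbb'] with y hy
        rw [hy]
      calc _ ≤ D⁻¹ * (D * ENNReal.ofReal r ^ (d - α * q)) := by
            rw [h]
            gcongr
            exact lintegral_ball_enorm_rpow_le_morreyENorm hq0 b x hr
        _ = _ := by rw [← mul_assoc, ENNReal.inv_mul_cancel hD0 hD', one_mul])
  have hDp : D ^ (p / q) ≠ 0 := (ENNReal.rpow_pos hD0.bot_lt hD').ne'
  have hDp' : D ^ (p / q) ≠ ∞ := ENNReal.rpow_ne_top_of_nonneg hpq0.le hD'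
  have hpt (x) : (‖b' x‖ₑ * rieszLIntegral α f' x) ^ p =
      D ^ (p / q) * ((D⁻¹ * ‖b' x‖ₑ ^ q) ^ (p / q) * rieszLIntegral α f' x ^ p) := by
    rw [ENNReal.mul_rpow_of_nonneg D⁻¹ _ hpq0.le, ENNReal.inv_rpow, ← ENNReal.rpow_mul,
      mul_div_cancel₀ _ hq0.ne', ← mul_assoc, ← mul_assoc, ENNReal.mul_inv_cancel hDp hDp',
      one_mul, ENNReal.mul_rpow_of_nonneg _ _ hp0.le]
  calc _ = ∫⁻ x, D ^ (p / q) *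
        ((D⁻¹ * ‖b' x‖ₑ ^ q) ^ (p / q) * rieszLIntegral α f' x ^ p) := by
        refine lintegral_congr_ae ?_
        filter_upwards [hbb'] with x hx
        rw [hx, hpot, hpt]
    _ = D ^ (p / q) * ∫⁻ x, (D⁻¹ * ‖b' x‖ₑ ^ q) ^ (p / q) * rieszLIntegral α f' x ^ p :=
        lintegral_const_mul' _ _ hDp'
    _ ≤ D ^ (p / q) * (C * ∫⁻ x, f' x ^ p) := by gcongr
    _ = D ^ (p / q) * (C * ∫⁻ x, f x ^ p) := by
        congr 2
        refine lintegral_congr_ae ?_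
        filter_upwards [hff'] with x hx
        rw [hx]
    _ = _ := by
        rw [ENNReal.mul_rpow_of_nonneg _ _ hp0.le, ENNReal.mul_rpow_of_nonneg _ _ hp0.le,
          ← ENNReal.rpow_mul, ← ENNReal.rpow_mul, one_div_mul_cancel hp0.ne', ENNReal.rpow_one,
          hD, ENNReal.mul_rpow_of_nonneg _ _ hpq0.le, ← ENNReal.rpow_mul,
          mul_div_cancel₀ _ hq0.ne', one_div_mul_eq_div]
        ring

/-! ### Real-valued potentials -/

theorem enorm_rieszIntegrand_le {α : ℝ} (hαd : α < d) (f : EuclideanSpace ℝ (Fin d) → ℝ)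
    (x y : EuclideanSpace ℝ (Fin d)) :
    ‖rieszIntegrand α f x y‖ₑ ≤ ‖f y‖ₑ * edist x y ^ (α - d) := by
  rcases eq_or_ne x y with rfl | hxy
  · -- division by zero makes the real integrand vanish on the diagonal
    have : (d : ℝ) - α ≠ 0 := by linarith
    simp [rieszIntegrand, Real.zero_rpow this]
  · have h : 0 < ‖x - y‖ := norm_pos_iff.2 (sub_ne_zero.2 hxy)
    rw [edist_dist, dist_eq_norm, ENNReal.ofReal_rpow_of_pos h, rieszIntegrand, div_eq_mul_inv,
      ← Real.rpow_neg h.le, enorm_mul, neg_sub, Real.enorm_of_nonneg (Real.rpow_nonneg h.le _)]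

theorem enorm_rieszPotential_le {α : ℝ} (hαd : α < d) (f : EuclideanSpace ℝ (Fin d) → ℝ)
    (x : EuclideanSpace ℝ (Fin d)) :
    ‖rieszPotential α f x‖ₑ ≤ rieszLIntegral α (fun y => ‖f y‖ₑ) x :=
  (enorm_integral_le_lintegral_enorm _).trans
    (lintegral_mono fun y => enorm_rieszIntegrand_le hαd f x y)

theorem integrable_rieszIntegrand {α : ℝ} (hαd : α < d) {f : EuclideanSpace ℝ (Fin d) → ℝ}
    (hf : AEStronglyMeasurable f volume) {x : EuclideanSpace ℝ (Fin d)}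
    (hx : rieszLIntegral α (fun y => ‖f y‖ₑ) x ≠ ∞) :
    Integrable (rieszIntegrand α f x) volume := by
  refine ⟨?_, (lintegral_mono fun y => enorm_rieszIntegrand_le hαd f x y).trans_lt hx.lt_top⟩
  refine (hf.aemeasurable.div ?_).aestronglyMeasurable
  exact ((measurable_const.sub measurable_id).norm.pow_const _).aemeasurable

theorem stronglyMeasurable_rieszPotential {α : ℝ} {f : EuclideanSpace ℝ (Fin d) → ℝ}
    (hf : AEStronglyMeasurable f volume) : StronglyMeasurable (rieszPotential α f) := by
  have h : rieszPotential α f = rieszPotential α (hf.mk f) := by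
    funext x
    refine integral_congr_ae ?_
    filter_upwards [hf.ae_eq_mk] with y hy
    rw [rieszIntegrand, rieszIntegrand, ← hy]
  rw [h]
  refine StronglyMeasurable.integral_prod_right (f := rieszIntegrand α (hf.mk f)) ?_
  refine Measurable.stronglyMeasurable ?_
  exact (hf.stronglyMeasurable_mk.measurable.comp measurable_snd).div
    ((measurable_fst.sub measurable_snd).norm.pow_const _)

theorem theorem2p1 (d : ℕ) (hd : 2 ≤ d) (α : ℝ) (hα : 0 < α) (hαd : α < d)
    (p q : ℝ) (hp : 1 < p) (hpq : p < q) :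
    ∃ N : ℝ≥0, ∀ b f : EuclideanSpace ℝ (Fin d) → ℝ,
      MemMorrey q α b → MemLp f (ENNReal.ofReal p) volume →
        (∀ᵐ x, b x ≠ 0 → Integrable (rieszIntegrand α f x) volume) ∧
        MemLp (fun x => b x * rieszPotential α f x) (ENNReal.ofReal p) volume ∧
        eLpNorm (fun x => b x * rieszPotential α f x) (ENNReal.ofReal p) volume ≤
          N * morreyENorm q α b * eLpNorm f (ENNReal.ofReal p) volume := by
  have : NeZero d := ⟨by omega⟩
  have hp0 : 0 < p := by linarith
  obtain ⟨N, hN⟩ := exists_lintegral_enorm_mul_rieszLIntegral_rpow_le (d := d) hα hαd hp hpq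
  refine ⟨N, fun b f hb hf => ?_⟩
  have hP0 : ENNReal.ofReal p ≠ 0 := by simpa using hp0
  have hnorm (g : EuclideanSpace ℝ (Fin d) → ℝ) :
      eLpNorm g (ENNReal.ofReal p) volume = (∫⁻ x, ‖g x‖ₑ ^ p) ^ (1 / p) := by
    rw [eLpNorm_eq_lintegral_rpow_enorm_toReal hP0 ENNReal.ofReal_ne_top,
      ENNReal.toReal_ofReal hp0.le]
  have hfm : AEMeasurable (fun y => ‖f y‖ₑ) volume := hf.1.enorm
  have key := hN b hb (fun y => ‖f y‖ₑ) hfm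
  set w := rieszLIntegral α (fun y => ‖f y‖ₑ) with hw
  have hwm : AEMeasurable w volume := by
    have h : w = rieszLIntegral α (hfm.mk _) := by
      funext x
      refine lintegral_congr_ae ?_
      filter_upwards [hfm.ae_eq_mk] with y hy
      rw [hy]
    rw [h]
    exact (measurable_rieszLIntegral hfm.measurable_mk).aemeasurable
  have hbound : eLpNorm (fun x => b x * rieszPotential α f x) (ENNReal.ofReal p) volume ≤
      N * morreyENorm q α b * eLpNorm f (ENNReal.ofReal p) volume := by
    rw [hnorm, hnorm]
    calc _ ≤ ((N * morreyENorm q α b) ^ p * ∫⁻ x, ‖f x‖ₑ ^ p) ^ (1 / p) := by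
          refine ENNReal.rpow_le_rpow (le_trans (lintegral_mono fun x => ?_) key) (by positivity)
          rw [enorm_mul]
          gcongr
          exact enorm_rieszPotential_le hαd f x
      _ = _ := by
          rw [ENNReal.mul_rpow_of_nonneg _ _ (by positivity), ← ENNReal.rpow_mul,
            mul_one_div_cancel hp0.ne', ENNReal.rpow_one]
  have hNB : (N : ℝ≥0∞) * morreyENorm q α b < ∞ := ENNReal.mul_lt_top ENNReal.coe_lt_top hb.2
  refine ⟨?_, ⟨?_, hbound.trans_lt (ENNReal.mul_lt_top hNB hf.2)⟩, hbound⟩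
  · have hfin : ∫⁻ x, ‖f x‖ₑ ^ p ≠ ∞ := by
      have := hf.2
      rw [hnorm] at this
      exact (ENNReal.rpow_lt_top_iff_of_pos (by positivity)).1 this |>.ne
    have hlt : ∫⁻ x, (‖b x‖ₑ * w x) ^ p ≠ ∞ :=
      (key.trans_lt (ENNReal.mul_lt_top (ENNReal.rpow_lt_top_of_nonneg hp0.le hNB.ne)
        hfin.lt_top)).ne
    filter_upwards [ae_lt_top' ((hb.1.enorm.mul hwm).pow_const _) hlt] with x hx hbx
    refine integrable_rieszIntegrand hαd hf.1 fun hwx => ?_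
    change (‖b x‖ₑ * w x) ^ p < ∞ at hx
    rw [← hw] at hwx
    rw [hwx, ENNReal.mul_top (by simpa using hbx), ENNReal.top_rpow_of_pos hp0] at hx
    exact lt_irrefl _ hx
  · exact hb.1.mul (stronglyMeasurable_rieszPotential hf.1).aestronglyMeasurable
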